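/- For an integer $n$ let $\mathbb{G}(n,p_2,p_3)$ be the random hypergraph on $n$ vertices in which, independently, each pair of vertices is an edge with probability $p_2$ and each triple of vertices is an edge with probability $p_3$. Let $0<\epsilon\le 1$ and $r>0$ be constants, $p_2=\frac{1-\epsilon}{n}$, $p_3=\frac{r}{n\ln n}$, $\lambda(x)=1-\epsilon+rx$, $\lambda_1(x)=1-\epsilon+\frac r2x$, $K_0=\max\{1,\lambda_1^{-1}(10)\}$ and $$I_{\epsilon,r}=\int_0^{\epsilon/r}\bigl[1-\lambda(\omega)+\ln\lambda(\omega)\bigr]\,d\omega .$$ For distinct vertices $v_1,v_2$, the propagation process starts with the active set $\{v_1,v_2\}$ (so $Y_0=2$) and no inactive vertices. As long as there are active vertices, an arbitrary active vertex $v$ is picked, every unexplored (neither active nor inactive) vertex $u$ for which there is a 2-edge $\{v,u\}$ or a 3-edge $\{v,w,u\}$ with $w$ inactive becomes active, and $v$ becomes inactive. $C_{v_1,v_2}$ is the set of vertices that become inactive (it does not depend on the picks). A hypergraph with vertex set $V$ is called propagation connected if there are edges $e_1,\dots,e_m$ with $\bigcup_i e_i=V$ and $|e_{l+1}\cap\bigcup_{i\le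 l}e_i|=|e_{l+1}|-1$ for all $1\le l<m$. (For $|V|=n$ this means $m=n-1$ if $|e_1|=2$ and $m=n-2$ if $|e_1|=3$.) Then: 1. There is a sequence $\eta_n\to0$, depending only on $\epsilon$ and $r$, such that for all sufficiently large $n$ and all distinct vertices $v_1,v_2$ of $\mathbb{G}(n,p_2,p_3)$, $$\Pr\bigl[|C_{v_1,v_2}|\ge K_0\ln n\bigr]\le n^{I_{\epsilon,r}+\eta_n}.$$ 2. If $I_{\epsilon,r}<-2$, then, as $n\to\infty$, the probability that there are distinct vertices $v_1,v_2$ with $|C_{v_1,v_2}|\ge K_0\ln n$ tends to $0$, and the probability that $\mathbb{G}(n,p_2,p_3)$ is not propagation connected tends to $1$. 3. (3-uniform case, $\epsilon=1$, $p_2=0$.) $I_{1,r}<-2$ if and only if $r<\frac14$; and if $r<\frac14$, then the random 3-uniform hypergraph $\mathbf{H}(n,p)=\mathbb{G}(n,0,p)$ with $p=\frac{r}{n\ln n}$ is not propagation connected with probability tending to $1$ as $n\to\infty$. -/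

import Mathlib

open MeasureTheory ProbabilityTheory Filter Topology

namespace PropConn

section Propagation

variable {V : Type*}

/-! ### The propagation process in a hypergraph with 2-edges and 3-edges -/

/-- A state `(𝒴, 𝒟)` of the propagation process. All other vertices are unexplored. -/
@[ext] structure State (V : Type*) where
  active : Set V
  inactive : Set V

/-- The unexplored vertices `u` that become active when the active vertex `v` is processed:
there is a 2-edge `{v, u}`, or a 3-edge `{v, w, u}` with `w` inactive. -/
def newlyActive (H : Hypergraph V) (s : State V) (v : V) : Set V :=
  {u | u ∉ s.active ∧ u ∉ s.inactive ∧
    (({v, u} : Set V) ∈ H.edgeSet ∨ ∃ w ∈ s.inactive, ({v, w, u} : Set V) ∈ H.edgeSet)}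

/-- One step of the process, processing the active vertex `v`. -/
def step (H : Hypergraph V) (s : State V) (v : V) : State V where
  active := (s.active ∪ newlyActive H s v) \ {v}
  inactive := insert v s.inactive

/-- The states that the process started with the active set `S` can reach; at each time an
arbitrary active vertex may be picked. -/
inductive Reachable (H : Hypergraph V) (S : Set V) : State V → Prop
  | start : Reachable H S ⟨S, ∅⟩
  | next (s : State V) (v : V) : Reachable H S s → v ∈ s.active → Reachable H S (step H s v)

/-- The component generated by the starting set `S`: all vertices that become inactive in the
propagation process. It does not depend on the order in which active vertices are picked, see
`component_eq_of_terminated`. -/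
def component (H : Hypergraph V) (S : Set V) : Set V :=
  {u | ∃ s : State V, Reachable H S s ∧ u ∈ s.inactive}

theorem Reachable.start_subset {H : Hypergraph V} {S : Set V} {s : State V}
    (h : Reachable H S s) : S ⊆ s.active ∪ s.inactive := by
  induction h with
  | start => exact Set.subset_union_left
  | next s v _ _ ih =>
    intro x hx
    by_cases hxv : x = v
    · exact Or.inr (Or.inl hxv)
    · rcases ih hx with h | h
      · exact Or.inl ⟨Or.inl h, hxv⟩
      · exact Or.inr (Or.inr h)

/-- Every vertex joined by an edge to processed vertices has been explored. -/
theorem Reachable.closed {H : Hypergraph V} {S : Set V} {s : State V} (h : Reachable H S s) :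
    (∀ v ∈ s.inactive, ∀ u, ({v, u} : Set V) ∈ H.edgeSet → u ∈ s.active ∪ s.inactive) ∧
    (∀ v ∈ s.inactive, ∀ w ∈ s.inactive, v ≠ w → ∀ u, ({v, w, u} : Set V) ∈ H.edgeSet →
      u ∈ s.active ∪ s.inactive) := by
  induction h with
  | start => exact ⟨fun v hv => hv.elim, fun v hv => hv.elim⟩
  | next s v _ _ ih =>
    have mono : ∀ x, x ∈ s.active ∪ s.inactive →
        x ∈ (step H s v).active ∪ (step H s v).inactive := by
      intro x hx
      by_cases hxv : x = v
      · exact Or.inr (Or.inl hxv)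
      · rcases hx with h | h
        · exact Or.inl ⟨Or.inl h, hxv⟩
        · exact Or.inr (Or.inr h)
    have new : ∀ u, (({v, u} : Set V) ∈ H.edgeSet ∨
        ∃ w ∈ s.inactive, ({v, w, u} : Set V) ∈ H.edgeSet) →
        u ∈ (step H s v).active ∪ (step H s v).inactive := by
      intro u hu
      by_cases hxv : u = v
      · exact Or.inr (Or.inl hxv)
      by_cases h1 : u ∈ s.active
      · exact mono u (Or.inl h1)
      by_cases h2 : u ∈ s.inactive
      · exact mono u (Or.inr h2)
      exact Or.inl ⟨Or.inr ⟨h1, h2, hu⟩, hxv⟩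
    refine ⟨?_, ?_⟩
    · rintro x (rfl | hx) u hu
      · exact new u (Or.inl hu)
      · exact mono u (ih.1 x hx u hu)
    · rintro x (rfl | hx) w (rfl | hw) hne u hu
      · exact (hne rfl).elim
      · exact new u (Or.inr ⟨w, hw, hu⟩)
      · exact new u (Or.inr ⟨x, hx, by rwa [Set.insert_comm]⟩)
      · exact mono u (ih.2 x hx w hw hne u hu)

theorem Reachable.disjoint {H : Hypergraph V} {S : Set V} {s : State V} (h : Reachable H S s) :
    ∀ x ∈ s.active, x ∉ s.inactive := by
  induction h with
  | start => exact fun _ _ h => h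
  | next s v _ _ ih =>
    rintro x ⟨hx, hxv⟩ (h | h)
    · exact hxv h
    · rcases hx with hx | hx
      · exact ih x hx h
      · exact hx.2.1 h

/-- Whatever vertices are picked, once no active vertex is left the inactive vertices are exactly
the component. -/
theorem component_eq_of_terminated {H : Hypergraph V} {S : Set V} {s : State V}
    (h : Reachable H S s) (hs : s.active = ∅) : component H S = s.inactive := by
  apply Set.Subset.antisymm
  · suffices key : ∀ t, Reachable H S t → t.active ∪ t.inactive ⊆ s.inactive by
      rintro u ⟨t, ht, hu⟩
      exact key t ht (Or.inr hu)
    intro t ht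
    have h0 := h.start_subset
    have hc := h.closed
    rw [hs, Set.empty_union] at h0 hc
    induction ht with
    | start => simpa using h0
    | next t v htr hv ih =>
      have hvs := ih (Or.inl hv)
      rintro x (⟨hx | hx, -⟩ | rfl | hx)
      · exact ih (Or.inl hx)
      · rcases hx with ⟨-, -, hx | ⟨w, hw, hx⟩⟩
        · exact hc.1 v hvs x hx
        · exact hc.2 v hvs w (ih (Or.inr hw))
            (fun hvw => htr.disjoint v hv (hvw ▸ hw)) x hx
      · exact hvs
      · exact ih (Or.inr hx)
  · exact fun u hu => ⟨s, h, hu⟩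

/-! ### Propagation connectivity -/

/-- `e 0, e 1, …, e (m - 1)` are edges of `H`, each of which, except the first one, has all but
exactly one of its vertices in the union of the preceding ones. -/
def IsPropagationSequence (H : Hypergraph V) {m : ℕ} (e : Fin m → Set V) : Prop :=
  (∀ i, e i ∈ H.edgeSet) ∧
    ∀ i : Fin m, 0 < (i : ℕ) → (e i ∩ ⋃ j < i, e j).ncard + 1 = (e i).ncard

/-- `H` is propagation connected if some propagation sequence exhausts its vertices. On `n`
vertices such a sequence consists of `n - 1` edges if its first edge is a 2-edge and of `n - 2`
edges if its first edge is a 3-edge, see `IsPropagationSequence.iUnion_eq_univ_iff`. -/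
def PropagationConnected (H : Hypergraph V) : Prop :=
  ∃ (m : ℕ) (e : Fin m → Set V), IsPropagationSequence H e ∧ ⋃ i, e i = H.vertexSet

theorem IsPropagationSequence.ncard_iUnion [Finite V] {H : Hypergraph V} {m : ℕ}
    {e : Fin (m + 1) → Set V} (h : IsPropagationSequence H e) :
    (⋃ i, e i).ncard = (e 0).ncard + m := by
  induction m with
  | zero =>
    have : (⋃ i, e i) = e 0 := by
      ext x; simp [Fin.exists_fin_one]
    simpa using congrArg Set.ncard this
  | succ m ih =>
    have hpre : IsPropagationSequence H (fun i : Fin (m + 1) => e i.castSucc) := by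
      refine ⟨fun i => h.1 _, fun i hi => ?_⟩
      have := h.2 i.castSucc (by simpa using hi)
      have hU : (⋃ j < i.castSucc, e j) = ⋃ j < i, e j.castSucc := by
        ext x
        simp only [Set.mem_iUnion, exists_prop]
        constructor
        · rintro ⟨j, hj, hx⟩
          exact ⟨⟨j, lt_trans hj i.2⟩, hj, hx⟩
        · rintro ⟨j, hj, hx⟩
          exact ⟨j.castSucc, hj, hx⟩
      rwa [hU] at this
    have ih' := ih hpre
    have hlast := h.2 (Fin.last (m + 1)) (by simp)
    have hU : (⋃ j < Fin.last (m + 1), e j) = ⋃ i : Fin (m + 1), e i.castSucc := by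
      ext x
      simp only [Set.mem_iUnion, exists_prop]
      constructor
      · rintro ⟨j, hj, hx⟩
        exact ⟨⟨j, hj⟩, hx⟩
      · rintro ⟨j, hx⟩
        exact ⟨j.castSucc, j.castSucc_lt_last, hx⟩
    rw [hU] at hlast
    have hall : (⋃ i, e i) = (⋃ i : Fin (m + 1), e i.castSucc) ∪ e (Fin.last (m + 1)) := by
      ext x
      simp only [Set.mem_iUnion, Set.mem_union, Fin.exists_fin_succ']
    have h1 := Set.ncard_union_add_ncard_inter (⋃ i : Fin (m + 1), e i.castSucc)
      (e (Fin.last (m + 1))) (Set.toFinite _) (Set.toFinite _)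
    rw [Set.inter_comm] at h1
    rw [hall]
    simp only [Fin.castSucc_zero] at ih'
    omega

theorem IsPropagationSequence.iUnion_eq_univ_iff [Finite V] {H : Hypergraph V} {m : ℕ}
    {e : Fin (m + 1) → Set V} (h : IsPropagationSequence H e) :
    ⋃ i, e i = Set.univ ↔ (e 0).ncard + m = Nat.card V := by
  rw [← h.ncard_iUnion, ← Set.ncard_univ]
  constructor
  · intro h'; rw [h']
  · intro h'
    exact Set.eq_of_subset_of_ncard_le (Set.subset_univ _) h'.ge

end Propagation

/-! ### The random hypergraph -/

/-- The possible edges on the vertex set `Fin n`: the 2-subsets and the 3-subsets. -/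
abbrev PossibleEdge (n : ℕ) : Type :=
  {e : Finset (Fin n) // e.card = 2 ∨ e.card = 3}

/-- The hypergraph on the vertex set `Fin n` whose edges are the possible edges `e` with
`ω e = true`. -/
def graph {n : ℕ} (ω : PossibleEdge n → Bool) : Hypergraph (Fin n) where
  vertexSet := Set.univ
  edgeSet := {A | ∃ e : PossibleEdge n, ω e = true ∧ (e.1 : Set (Fin n)) = A}
  subset_vertexSet_of_mem_edgeSet' := fun _ _ => Set.subset_univ _

/-- The law of `𝔾(n, p₂, p₃)`: independently, each 2-subset is an edge with probability `p₂` and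
each 3-subset is an edge with probability `p₃`. (Values outside `[0, 1]` are replaced by the
nearest endpoint.) -/
noncomputable def randomHypergraph (n : ℕ) (p₂ p₃ : ℝ) : Measure (PossibleEdge n → Bool) :=
  Measure.pi fun e => bernoulliMeasure true false
    (Set.projIcc (0 : ℝ) 1 zero_le_one (if e.1.card = 2 then p₂ else p₃))

instance (n : ℕ) (p₂ p₃ : ℝ) : IsProbabilityMeasure (randomHypergraph n p₂ p₃) := by
  unfold randomHypergraph; infer_instance

/-! ### The constants -/

/-- `λ(x) = 1 - ε + r x`. -/
noncomputable def lam (ε r x : ℝ) : ℝ := 1 - ε + r * x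

/-- `λ₁(x) = 1 - ε + (r / 2) x`. -/
noncomputable def lam₁ (ε r x : ℝ) : ℝ := 1 - ε + r / 2 * x

/-- `I_{ε,r} = ∫₀^{ε/r} (1 - λ(ω) + ln λ(ω)) dω`. -/
noncomputable def rate (ε r : ℝ) : ℝ :=
  ∫ ω in (0 : ℝ)..(ε / r), (1 - lam ε r ω + Real.log (lam ε r ω))

/-- `K₀ = max {1, λ₁⁻¹(10)}`, see `lam₁_eq_ten_iff`. -/
noncomputable def K₀ (ε r : ℝ) : ℝ := max 1 (2 * (9 + ε) / r)

theorem lam₁_eq_ten_iff {ε r : ℝ} (hr : 0 < r) (x : ℝ) :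
    lam₁ ε r x = 10 ↔ x = 2 * (9 + ε) / r := by
  unfold lam₁
  rw [eq_div_iff hr.ne']
  constructor <;> intro h <;> linarith

end PropConn

/-! A component with at least K₀ ln n vertices forces the exploration from two vertices to survive
about (ε/r) ln n steps. With t inactive vertices, the mean number of discoveries in a step is at
most λ(t / ln n), which stays below 1 until t reaches (ε/r) ln n. Surviving this window is therefore
a large deviation.

Processing v with inactive set D only looks at edges made of v, one further vertex outside D, and
vertices of D. Everything later depends on edges with two vertices outside D ∪ {v}. So each step is
independent of what follows (`measureReal_pi_inter_of_dependsOn`), and an exponential tilt τ bounds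
its contribution by exp((e^τ - 1)λ - τ), the -τ paying for the processed vertex. The best tilt is
e^τ = 1/λ, with exponent 1 - λ + ln λ. It decreases in time because λ grows, which is what allows it
to vary from step to step (`measureReal_survives_le`). The sum of the exponents is compared with ln
n times the integral I, up to o(ln n) (`tail_bound`, `tendsto_tailError`).

If I < -2, a union bound over the pairs of starting vertices leaves a negative power of n. A
propagation sequence never leaves the component of two vertices of its first edge
(`PropagationConnected.exists_component_eq_univ`), so connectivity would make one of these
components contain all n vertices. -/

namespace PropConn

/-! ### Termination and survival of the exploration process -/

section Exploration

variable {V : Type*}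

theorem Reachable.exists_terminated [Finite V] {H : Hypergraph V} {S : Set V} {s : State V}
    (h : Reachable H S s) : ∃ t, Reachable H S t ∧ t.active = ∅ := by
  induction hk : (s.inactiveᶜ).ncard using Nat.strong_induction_on generalizing s with
  | _ k ih =>
    rcases s.active.eq_empty_or_nonempty with h0 | ⟨v, hv⟩
    · exact ⟨s, h, h0⟩
    · refine ih _ ?_ (Reachable.next s v h hv) rfl
      rw [← hk]
      refine Set.ncard_lt_ncard ?_ (Set.toFinite _)
      exact compl_lt_compl_iff_lt.2 (Set.ssubset_iff_insert.2 ⟨v, h.disjoint v hv, subset_rfl⟩)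

/-- The component is closed under edges all but one of whose vertices it contains. -/
theorem component_closed [Finite V] (H : Hypergraph V) (S : Set V) :
    S ⊆ component H S ∧
    (∀ v ∈ component H S, ∀ u, ({v, u} : Set V) ∈ H.edgeSet → u ∈ component H S) ∧
    (∀ v ∈ component H S, ∀ w ∈ component H S, v ≠ w → ∀ u,
      ({v, w, u} : Set V) ∈ H.edgeSet → u ∈ component H S) := by
  obtain ⟨t, ht, h0⟩ := (Reachable.start (H := H) (S := S)).exists_terminated
  rw [component_eq_of_terminated ht h0]
  have h1 := ht.start_subset
  have h2 := ht.closed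
  rw [h0, Set.empty_union] at h1 h2
  exact ⟨h1, h2⟩

/-- The process on `H`, continued from the state `s`, processes at least `k` further vertices. -/
def Survives (H : Hypergraph V) : ℕ → State V → Prop
  | 0, _ => True
  | k + 1, s => ∃ h : s.active.Nonempty, Survives H k (step H s h.some)

/-- A process that stopped earlier would have the whole component as its inactive set, by
`component_eq_of_terminated`, and that set would be too small. This turns a large component into
survival under one fixed rule for picking active vertices. -/
theorem Reachable.survives [Finite V] {H : Hypergraph V} {S : Set V} {s : State V}
    (h : Reachable H S s) (k : ℕ) (hk : s.inactive.ncard + k ≤ (component H S).ncard) :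
    Survives H k s := by
  induction k generalizing s with
  | zero => trivial
  | succ k ih =>
    rcases s.active.eq_empty_or_nonempty with h0 | hne
    · rw [component_eq_of_terminated h h0] at hk
      omega
    · refine ⟨hne, ih (Reachable.next s _ h hne.some_mem) ?_⟩
      have := Set.ncard_insert_le hne.some s.inactive
      simp only [step]
      omega

/-- The state after `v` has been processed, when the vertices of `A` have been discovered. -/
def advance (s : State V) (v : V) (A : Set V) : State V where
  active := (s.active ∪ A) \ {v}
  inactive := insert v s.inactive

theorem step_eq_advance (H : Hypergraph V) (s : State V) (v : V) :
    step H s v = advance s v (newlyActive H s v) := rfl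

theorem disjoint_advance {s : State V} (hs : Disjoint s.active s.inactive) (v : V) {A : Set V}
    (hA : Disjoint A s.inactive) :
    Disjoint (advance s v A).active (advance s v A).inactive := by
  rw [Set.disjoint_left] at *
  rintro x ⟨hx, hxv⟩ (h | h)
  · exact hxv h
  · exact hx.elim (fun hx => hs hx h) (fun hx => hA hx h)

theorem newlyActive_disjoint (H : Hypergraph V) (s : State V) (v : V) :
    Disjoint (newlyActive H s v) s.inactive :=
  Set.disjoint_left.2 fun _ hx => hx.2.1

end Exploration

/-! ### Dependence of the process on the edges -/

section Dependence

variable {n : ℕ}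

/-- The possible edges with at least two vertices outside `D`. -/
def freshEdges (D : Set (Fin n)) : Set (PossibleEdge n) :=
  {e | ∃ a ∈ e.1, ∃ b ∈ e.1, a ≠ b ∧ a ∉ D ∧ b ∉ D}

/-- The possible edges consisting of `v`, one further vertex outside `D`, and vertices in `D`. -/
def revealedEdges (D : Set (Fin n)) (v : Fin n) : Set (PossibleEdge n) :=
  {e | ∃ u, u ∉ D ∧ u ≠ v ∧ (e.1 : Set (Fin n)) \ D = {v, u}}

theorem revealedEdges_subset_freshEdges (D : Set (Fin n)) (v : Fin n) :
    revealedEdges D v ⊆ freshEdges D := by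
  rintro e ⟨u, hu, huv, he⟩
  have h1 : v ∈ (e.1 : Set (Fin n)) \ D := by simp [he]
  have h2 : u ∈ (e.1 : Set (Fin n)) \ D := by simp [he]
  exact ⟨v, h1.1, u, h2.1, huv.symm, h1.2, h2.2⟩

theorem freshEdges_anti {D D' : Set (Fin n)} (h : D ⊆ D') : freshEdges D' ⊆ freshEdges D := by
  rintro e ⟨a, ha, b, hb, hab, haD, hbD⟩
  exact ⟨a, ha, b, hb, hab, fun h' => haD (h h'), fun h' => hbD (h h')⟩

/-- A revealed edge keeps only one vertex outside `insert v D`, and a fresh one needs two. Hence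
what one step exposes is never consulted again. -/
theorem disjoint_revealedEdges_freshEdges (D : Set (Fin n)) (v : Fin n) :
    Disjoint (revealedEdges D v) (freshEdges (insert v D)) := by
  rw [Set.disjoint_left]
  rintro e ⟨u, hu, huv, he⟩ ⟨a, ha, b, hb, hab, haD, hbD⟩
  simp only [Set.mem_insert_iff, not_or] at haD hbD
  have h1 : a ∈ (e.1 : Set (Fin n)) \ D := ⟨ha, haD.2⟩
  have h2 : b ∈ (e.1 : Set (Fin n)) \ D := ⟨hb, hbD.2⟩
  rw [he] at h1 h2
  simp only [Set.mem_insert_iff, Set.mem_singleton_iff] at h1 h2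
  exact hab ((h1.resolve_left haD.1).trans (h2.resolve_left hbD.1).symm)

/-- A newly discovered vertex is joined to `v` by a revealed edge that is present. -/
theorem exists_revealedEdge {ω : PossibleEdge n → Bool} {s : State (Fin n)}
    (hs : Disjoint s.active s.inactive) {v u : Fin n} (hv : v ∈ s.active)
    (hu : u ∈ newlyActive (graph ω) s v) :
    ∃ e ∈ revealedEdges s.inactive v, ω e = true ∧ (e.1 : Set (Fin n)) \ s.inactive = {v, u} ∧
      ((e.1 : Set (Fin n)) = {v, u} ∨ ∃ w ∈ s.inactive, (e.1 : Set (Fin n)) = {v, w, u}) := by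
  obtain ⟨h1, h2, h3⟩ := hu
  have hvD := Set.disjoint_left.1 hs hv
  have huv : u ≠ v := fun h => h1 (h ▸ hv)
  have key : ∀ e : PossibleEdge n,
      ((e.1 : Set (Fin n)) = {v, u} ∨ ∃ w ∈ s.inactive, (e.1 : Set (Fin n)) = {v, w, u}) →
      (e.1 : Set (Fin n)) \ s.inactive = {v, u} := by
    rintro e (he | ⟨w, hw, he⟩) <;> rw [he] <;> ext x <;>
      simp only [Set.mem_sdiff, Set.mem_insert_iff, Set.mem_singleton_iff] <;>
      constructor
    · exact fun h => h.1
    · rintro (rfl | rfl) <;> simp_all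
    · rintro ⟨rfl | rfl | rfl, h⟩ <;> simp_all
    · rintro (rfl | rfl) <;> simp_all
  have : ∃ e : PossibleEdge n, ω e = true ∧
      ((e.1 : Set (Fin n)) = {v, u} ∨ ∃ w ∈ s.inactive, (e.1 : Set (Fin n)) = {v, w, u}) := by
    rcases h3 with ⟨e, he, h⟩ | ⟨w, hw, e, he, h⟩
    · exact ⟨e, he, Or.inl h⟩
    · exact ⟨e, he, Or.inr ⟨w, hw, h⟩⟩
  obtain ⟨e, he, h⟩ := this
  exact ⟨e, ⟨u, h2, huv, key e h⟩, he, key e h, h⟩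

theorem newlyActive_congr {s : State (Fin n)} (hs : Disjoint s.active s.inactive) {v : Fin n}
    (hv : v ∈ s.active) {ω ω' : PossibleEdge n → Bool}
    (h : ∀ e ∈ revealedEdges s.inactive v, ω e = ω' e) :
    newlyActive (graph ω) s v = newlyActive (graph ω') s v := by
  have key : ∀ ω ω' : PossibleEdge n → Bool,
      (∀ e ∈ revealedEdges s.inactive v, ω e = ω' e) →
      newlyActive (graph ω) s v ⊆ newlyActive (graph ω') s v := by
    intro ω ω' h u hu
    obtain ⟨e, he, h1, -, h2⟩ := exists_revealedEdge hs hv hu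
    rw [h e he] at h1
    refine ⟨hu.1, hu.2.1, ?_⟩
    rcases h2 with h2 | ⟨w, hw, h2⟩
    · exact Or.inl ⟨e, h1, h2⟩
    · exact Or.inr ⟨w, hw, e, h1, h2⟩
  exact (key _ _ h).antisymm (key _ _ fun e he => (h e he).symm)

/-- The current step reads only revealed edges, which are fresh, and the later steps read edges that
are fresh for a larger inactive set. -/
theorem dependsOn_survives (k : ℕ) {s : State (Fin n)} (hs : Disjoint s.active s.inactive) :
    DependsOn (fun ω : PossibleEdge n → Bool => Survives (graph ω) k s)
      (freshEdges s.inactive) := by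
  induction k generalizing s with
  | zero => exact fun _ _ _ => rfl
  | succ k ih =>
    intro ω ω' h
    simp only [Survives, step_eq_advance]
    refine propext (exists_congr fun hne => ?_)
    rw [newlyActive_congr hs hne.some_mem
      (fun e he => h e (revealedEdges_subset_freshEdges _ _ he))]
    exact iff_of_eq (ih (disjoint_advance hs _ (newlyActive_disjoint _ _ _))
      (fun e he => h e (freshEdges_anti (Set.subset_insert _ _) he)))

/-- The number of newly discovered vertices is at most the number of revealed edges present. -/
theorem ncard_newlyActive_le {ω : PossibleEdge n → Bool} {s : State (Fin n)}
    (hs : Disjoint s.active s.inactive) {v : Fin n} (hv : v ∈ s.active) :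
    (newlyActive (graph ω) s v).ncard
      ≤ {e | e ∈ revealedEdges s.inactive v ∧ ω e = true}.ncard := by
  rcases (newlyActive (graph ω) s v).eq_empty_or_nonempty with h0 | ⟨u₀, hu₀⟩
  · simp [h0]
  have : Nonempty (PossibleEdge n) := ⟨(exists_revealedEdge hs hv hu₀).choose⟩
  choose! f hf using fun u (hu : u ∈ newlyActive (graph ω) s v) => exists_revealedEdge hs hv hu
  -- The chosen edge determines u, since its part outside the inactive set is {v, u}.
  refine Set.ncard_le_ncard_of_injOn f (fun u hu => ⟨(hf u hu).1, (hf u hu).2.1⟩) ?_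
    (Set.toFinite _)
  intro a ha b hb hab
  have h1 := (hf a ha).2.2.1
  rw [hab, (hf b hb).2.2.1] at h1
  have h2 : a ∈ ({v, b} : Set (Fin n)) := by rw [h1]; simp
  rcases h2 with rfl | h2
  · exact (ha.1 hv).elim
  · exact h2

end Dependence

/-! ### Propagation sequences stay inside a component -/

/-- Any two vertices of a first edge of size 3 generate the third, so the first edge lies in a
component of two vertices. Each later edge has at most one vertex outside the union of its
predecessors, so closedness of the component absorbs it. -/
theorem PropagationConnected.exists_component_eq_univ {n : ℕ} [NeZero n]
    {ω : PossibleEdge n → Bool} (h : PropagationConnected (graph ω)) :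
    ∃ v₁ v₂ : Fin n, v₁ ≠ v₂ ∧ component (graph ω) {v₁, v₂} = Set.univ := by
  obtain ⟨m, e, ⟨he, hp⟩, hU⟩ := h
  change _ = Set.univ at hU
  have hm : 0 < m := by
    rcases Nat.eq_zero_or_pos m with rfl | hm
    · have : (0 : Fin n) ∈ ⋃ i, e i := by rw [hU]; trivial
      simp at this
    · exact hm
  obtain ⟨v₁, v₂, hne, h0⟩ : ∃ v₁ v₂ : Fin n, v₁ ≠ v₂ ∧
      e ⟨0, hm⟩ ⊆ component (graph ω) {v₁, v₂} := by
    have hE := he ⟨0, hm⟩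
    obtain ⟨f, hf, hfe⟩ := hE
    rcases f.2 with h2 | h3
    · obtain ⟨a, b, hab, h⟩ := Finset.card_eq_two.1 h2
      refine ⟨a, b, hab, ?_⟩
      rw [← hfe, h]
      simpa using (component_closed (graph ω) {a, b}).1
    · obtain ⟨a, b, c, hab, -, -, h⟩ := Finset.card_eq_three.1 h3
      obtain ⟨c1, -, c3⟩ := component_closed (graph ω) {a, b}
      have ha := c1 (show a ∈ _ by simp)
      have hb := c1 (show b ∈ _ by simp)
      refine ⟨a, b, hab, ?_⟩
      have hc := c3 a ha b hb hab c ⟨f, hf, by simp [h]⟩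
      rw [← hfe, h]
      intro x hx
      simp only [Finset.coe_insert, Finset.coe_singleton, Set.mem_insert_iff,
        Set.mem_singleton_iff] at hx
      rcases hx with rfl | rfl | rfl <;> assumption
  refine ⟨v₁, v₂, hne, ?_⟩
  obtain ⟨-, c2, c3⟩ := component_closed (graph ω) {v₁, v₂}
  set C := component (graph ω) {v₁, v₂}
  have key : ∀ k (hk : k < m), e ⟨k, hk⟩ ⊆ C := by
    intro k
    induction k using Nat.strong_induction_on with
    | _ k ih =>
      intro hk
      rcases Nat.eq_zero_or_pos k with rfl | hpos
      · exact h0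
      have hcard := hp ⟨k, hk⟩ hpos
      have hsub : (⋃ j < (⟨k, hk⟩ : Fin m), e j) ⊆ C :=
        Set.iUnion₂_subset fun j hj => ih j hj j.2
      have hdiff : (e ⟨k, hk⟩ \ C).ncard ≤ 1 := by
        have h1 := Set.ncard_le_ncard (Set.inter_subset_inter_right (e ⟨k, hk⟩) hsub)
          (Set.toFinite _)
        have h2 := Set.ncard_inter_add_ncard_sdiff_eq_ncard (e ⟨k, hk⟩) C (Set.toFinite _)
        omega
      rw [Set.ncard_le_one (Set.toFinite _)] at hdiff
      intro u hu
      by_contra huC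
      have hin : ∀ x ∈ e ⟨k, hk⟩, x ≠ u → x ∈ C := fun x hx hxu => by
        by_contra hxC
        exact hxu (hdiff x ⟨hx, hxC⟩ u ⟨hu, huC⟩)
      obtain ⟨f, hf, hfe⟩ := he ⟨k, hk⟩
      rw [← hfe] at hu hin
      have hu' : u ∈ f.1 := hu
      have hins := Finset.insert_erase hu'
      have hcd := Finset.card_erase_of_mem hu'
      rcases f.2 with h2 | h3
      · obtain ⟨a, ha⟩ := Finset.card_eq_one.1 (show (f.1.erase u).card = 1 by omega)
        have ham : a ∈ f.1.erase u := by simp [ha]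
        rw [Finset.mem_erase] at ham
        refine huC (c2 a (hin a ham.2 ham.1) u ⟨f, hf, ?_⟩)
        rw [← hins, ha]
        ext x; simp [or_comm]
      · obtain ⟨a, b, hab, ha⟩ := Finset.card_eq_two.1 (show (f.1.erase u).card = 2 by omega)
        have ham : a ∈ f.1.erase u := by simp [ha]
        have hbm : b ∈ f.1.erase u := by simp [ha]
        rw [Finset.mem_erase] at ham hbm
        refine huC (c3 a (hin a ham.2 ham.1) b (hin b hbm.2 hbm.1) hab u ⟨f, hf, ?_⟩)
        rw [← hins, ha]
        ext x; simp; tauto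
  rw [← Set.univ_subset_iff, ← hU]
  exact Set.iUnion_subset fun i => key i i.2

/-! ### Product measures -/

section Product

variable {ι : Type*} [Fintype ι] {α : Type*} [MeasurableSpace α]

theorem indepFun_restrict_pi (m : ι → Measure α) [∀ i, IsProbabilityMeasure (m i)]
    {S T : Finset ι} (hST : Disjoint S T) :
    IndepFun (fun (ω : ι → α) (i : S) => ω i) (fun (ω : ι → α) (i : T) => ω i) (Measure.pi m) :=
  iIndepFun.indepFun_finset (f := fun i (ω : ι → α) => ω i) S T hST
    (iIndepFun_pi (X := fun _ x => x) fun _ => aemeasurable_id) fun i => measurable_pi_apply i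

/-- Events that depend on disjoint sets of coordinates are independent. -/
theorem measureReal_pi_inter_of_dependsOn [DiscreteMeasurableSpace α] [Countable α]
    (m : ι → Measure α) [∀ i, IsProbabilityMeasure (m i)]
    {p q : (ι → α) → Prop} {S T : Set ι} (hp : DependsOn p S) (hq : DependsOn q T)
    (hST : Disjoint S T) :
    (Measure.pi m).real ({ω | p ω} ∩ {ω | q ω})
      = (Measure.pi m).real {ω | p ω} * (Measure.pi m).real {ω | q ω} := by
  classical
  -- An event depending only on R is the preimage of its own image under restriction to R, so
  -- independence of the two restrictions applies.
  have key : ∀ {r : (ι → α) → Prop} {R : Set ι}, DependsOn r R →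
      {ω | r ω} = (fun (ω : ι → α) (i : R.toFinset) => ω i) ⁻¹'
        ((fun (ω : ι → α) (i : R.toFinset) => ω i) '' {ω | r ω}) := by
    intro r R hr
    refine (Set.subset_preimage_image _ _).antisymm ?_
    rintro ω ⟨ω', h1, h2⟩
    have : r ω' = r ω := hr fun i hi => congrFun h2 ⟨i, by simpa using hi⟩
    exact (iff_of_eq this).1 h1
  have hi := indepFun_restrict_pi m (S := S.toFinset) (T := T.toFinset) (by simpa using hST)
  rw [key hp, key hq, measureReal_def, hi.measure_inter_preimage_eq_mul _ _ .of_discrete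
    .of_discrete, ENNReal.toReal_mul]
  rfl

end Product

/-! ### Exponential moments and the supermartingale bound -/

section RandomHypergraph

variable {n : ℕ} {p₂ p₃ : ℝ}

theorem integral_prod_edges (f : PossibleEdge n → Bool → ℝ) :
    ∫ ω, ∏ e, f e (ω e) ∂(randomHypergraph n p₂ p₃)
      = ∏ e : PossibleEdge n, ((Set.projIcc (0 : ℝ) 1 zero_le_one
          (if e.1.card = 2 then p₂ else p₃) : ℝ) * f e true
        + (1 - (Set.projIcc (0 : ℝ) 1 zero_le_one
          (if e.1.card = 2 then p₂ else p₃) : ℝ)) * f e false) := by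
  unfold randomHypergraph
  rw [integral_fintype_prod_eq_prod]
  refine Finset.prod_congr rfl fun e _ => ?_
  rw [integral_bernoulliMeasure]
  rfl

/-- The exponential moment of the number of edges in `B` that are present. -/
theorem integral_exp_ncard_le (h₂ : 0 ≤ p₂) (h₃ : 0 ≤ p₃) (B : Set (PossibleEdge n)) {τ : ℝ}
    (hτ : 0 ≤ τ) :
    ∫ ω, Real.exp (τ * ({e | e ∈ B ∧ ω e = true}.ncard : ℝ)) ∂(randomHypergraph n p₂ p₃)
      ≤ Real.exp ((Real.exp τ - 1) * ({e | e ∈ B ∧ e.1.card = 2}.ncard * p₂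
        + {e | e ∈ B ∧ e.1.card = 3}.ncard * p₃)) := by
  classical
  have hτ' : 0 ≤ Real.exp τ - 1 := by linarith [Real.one_le_exp hτ]
  have h1 : ∀ ω : PossibleEdge n → Bool,
      Real.exp (τ * ({e | e ∈ B ∧ ω e = true}.ncard : ℝ))
        = ∏ e, if e ∈ B ∧ ω e = true then Real.exp τ else 1 := by
    intro ω
    rw [Finset.prod_ite, Finset.prod_const, Finset.prod_const_one, mul_one, ← Real.exp_nat_mul,
      mul_comm, Set.ncard_eq_toFinset_card', Set.toFinset_ofPred]
  simp_rw [h1]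
  rw [integral_prod_edges (fun e b => if e ∈ B ∧ b = true then Real.exp τ else 1)]
  have h2 : (Real.exp τ - 1) * ({e | e ∈ B ∧ e.1.card = 2}.ncard * p₂
        + {e | e ∈ B ∧ e.1.card = 3}.ncard * p₃)
      = ∑ e : PossibleEdge n, (Real.exp τ - 1) *
        ((if e ∈ B ∧ e.1.card = 2 then p₂ else 0) + if e ∈ B ∧ e.1.card = 3 then p₃ else 0) := by
    rw [← Finset.mul_sum, Finset.sum_add_distrib, ← Finset.sum_filter, ← Finset.sum_filter,
      Finset.sum_const, Finset.sum_const, Set.ncard_eq_toFinset_card', Set.toFinset_ofPred,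
      Set.ncard_eq_toFinset_card', Set.toFinset_ofPred, nsmul_eq_mul, nsmul_eq_mul]
  rw [h2, Real.exp_sum]
  refine Finset.prod_le_prod (fun e _ => ?_) fun e _ => ?_
  · set q := Set.projIcc (0 : ℝ) 1 zero_le_one (if e.1.card = 2 then p₂ else p₃)
    have hq := q.2
    have : 0 ≤ 1 - (q : ℝ) := by linarith [hq.2]
    have := hq.1
    split_ifs <;> positivity
  -- Clamping to [0, 1] cannot increase a nonnegative number, so no upper bound on p₂ and p₃ is
  -- needed.
  · have hq : (Set.projIcc (0 : ℝ) 1 zero_le_one (if e.1.card = 2 then p₂ else p₃) : ℝ)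
        ≤ if e.1.card = 2 then p₂ else p₃ := by
      rw [Set.coe_projIcc]
      refine max_le ?_ (min_le_right _ _)
      split_ifs <;> assumption
    set q : ℝ := (Set.projIcc (0 : ℝ) 1 zero_le_one (if e.1.card = 2 then p₂ else p₃) : ℝ)
    by_cases heB : e ∈ B
    · simp only [heB, true_and, if_true, Bool.false_eq_true, if_false]
      -- The moment of one edge is 1 + (e^τ - 1)q, at most exp((e^τ - 1)q).
      refine le_trans (b := (Real.exp τ - 1) * q + 1) (by linarith) ?_
      refine (Real.add_one_le_exp _).trans (Real.exp_le_exp.2 ?_)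
      refine mul_le_mul_of_nonneg_left (hq.trans ?_) hτ'
      rcases e.2 with h | h <;> simp [h]
    · simp [heB]

theorem ncard_revealedEdges_two (D : Set (Fin n)) (v : Fin n) :
    {e | e ∈ revealedEdges D v ∧ e.1.card = 2}.ncard ≤ n := by
  classical
  rw [← Set.ncard_image_of_injective _ Subtype.val_injective]
  calc _ ≤ ((fun u => ({v, u} : Finset (Fin n))) '' Set.univ).ncard := by
        refine Set.ncard_le_ncard ?_ (Set.toFinite _)
        rintro _ ⟨e, ⟨⟨u, hu, huv, he⟩, hc⟩, rfl⟩
        have h1 : v ∈ (e.1 : Set (Fin n)) \ D := by simp [he]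
        have h2 : u ∈ (e.1 : Set (Fin n)) \ D := by simp [he]
        refine ⟨u, trivial, Finset.eq_of_subset_of_card_le ?_ ?_⟩
        · exact Finset.insert_subset h1.1 (Finset.singleton_subset_iff.2 h2.1)
        · rw [hc, Finset.card_pair huv.symm]
    _ ≤ (Set.univ : Set (Fin n)).ncard := Set.ncard_image_le (Set.toFinite _)
    _ = n := by simp

/-- Such an edge is {v, w, u} with w in D, hence named by the pair (w, u). -/
theorem ncard_revealedEdges_three (D : Set (Fin n)) (v : Fin n) :
    {e | e ∈ revealedEdges D v ∧ e.1.card = 3}.ncard ≤ D.ncard * n := by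
  classical
  rw [← Set.ncard_image_of_injective _ Subtype.val_injective]
  calc _ ≤ ((fun x : Fin n × Fin n => ({v, x.1, x.2} : Finset (Fin n)))
          '' (D ×ˢ Set.univ)).ncard := by
        refine Set.ncard_le_ncard ?_ (Set.toFinite _)
        rintro _ ⟨e, ⟨⟨u, hu, huv, he⟩, hc⟩, rfl⟩
        have h1 : v ∈ (e.1 : Set (Fin n)) \ D := by simp [he]
        have h2 : u ∈ (e.1 : Set (Fin n)) \ D := by simp [he]
        obtain ⟨w, hw, hwn⟩ := Finset.exists_mem_notMem_of_card_lt_card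
          (show ({v, u} : Finset (Fin n)).card < e.1.card by
            rw [hc, Finset.card_pair huv.symm]; norm_num)
        have hwD : w ∈ D := by
          by_contra hwD
          have h3 : w ∈ (e.1 : Set (Fin n)) \ D := ⟨hw, hwD⟩
          rw [he] at h3
          exact hwn (by simpa using h3)
        simp only [Finset.mem_insert, Finset.mem_singleton, not_or] at hwn
        refine ⟨(w, u), ⟨hwD, trivial⟩, Finset.eq_of_subset_of_card_le ?_ ?_⟩
        · exact Finset.insert_subset h1.1 (Finset.insert_subset hw
            (Finset.singleton_subset_iff.2 h2.1))
        · rw [hc, Finset.card_eq_three.2 ⟨v, w, u, Ne.symm hwn.1, huv.symm, hwn.2, rfl⟩]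
    _ ≤ (D ×ˢ (Set.univ : Set (Fin n))).ncard := Set.ncard_image_le (Set.toFinite _)
    _ = D.ncard * n := by simp [Set.ncard_prod]

/-- The exponential moment of the number of newly discovered vertices. -/
theorem integral_exp_newlyActive_le (h₂ : 0 ≤ p₂) (h₃ : 0 ≤ p₃) {s : State (Fin n)}
    (hs : Disjoint s.active s.inactive) {v : Fin n} (hv : v ∈ s.active) {τ : ℝ} (hτ : 0 ≤ τ) :
    ∫ ω, Real.exp (τ * ((newlyActive (graph ω) s v).ncard : ℝ)) ∂(randomHypergraph n p₂ p₃)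
      ≤ Real.exp ((Real.exp τ - 1) * (n * p₂ + s.inactive.ncard * n * p₃)) := by
  have hτ' : 0 ≤ Real.exp τ - 1 := by linarith [Real.one_le_exp hτ]
  refine le_trans (integral_mono .of_finite .of_finite fun ω => ?_)
    ((integral_exp_ncard_le h₂ h₃ (revealedEdges s.inactive v) hτ).trans ?_)
  · refine Real.exp_le_exp.2 (mul_le_mul_of_nonneg_left ?_ hτ)
    exact_mod_cast ncard_newlyActive_le hs hv
  · refine Real.exp_le_exp.2 (mul_le_mul_of_nonneg_left ?_ hτ')
    gcongr
    · exact ncard_revealedEdges_two _ _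
    · exact_mod_cast ncard_revealedEdges_three _ _

/-- Supermartingale bound for the probability that the process survives `k` further steps, with an
exponential tilt `τ t` that decreases in time. -/
theorem measureReal_survives_le (h₂ : 0 ≤ p₂) (h₃ : 0 ≤ p₃) {τ : ℕ → ℝ} (hτ : ∀ t, 0 ≤ τ t)
    (hanti : Antitone τ) (k : ℕ) {s : State (Fin n)} (hs : Disjoint s.active s.inactive) :
    (randomHypergraph n p₂ p₃).real {ω | Survives (graph ω) k s}
      ≤ Real.exp (τ s.inactive.ncard * s.active.ncard + ∑ i ∈ Finset.range k,
        ((Real.exp (τ (s.inactive.ncard + i)) - 1)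
            * (n * p₂ + ((s.inactive.ncard + i : ℕ) : ℝ) * n * p₃)
          - τ (s.inactive.ncard + i))) := by
  classical
  induction k generalizing s with
  | zero =>
    refine measureReal_le_one.trans (Real.one_le_exp ?_)
    have := hτ s.inactive.ncard
    simp only [Finset.range_zero, Finset.sum_empty, add_zero]
    positivity
  | succ k ih =>
    rcases s.active.eq_empty_or_nonempty with h0 | hne
    · have : {ω : PossibleEdge n → Bool | Survives (graph ω) (k + 1) s} = ∅ := by
        ext ω
        simp [Survives, h0]
      rw [this, measureReal_empty]
      positivity
    set v := hne.some
    have hv : v ∈ s.active := hne.some_mem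
    set t := s.inactive.ncard
    set P := randomHypergraph n p₂ p₃ with hP
    set N : (PossibleEdge n → Bool) → Set (Fin n) := fun ω => newlyActive (graph ω) s v
    set g : ℕ → ℝ := fun i => (Real.exp (τ i) - 1) * (n * p₂ + (i : ℝ) * n * p₃) - τ i with hg
    change _ ≤ Real.exp (τ t * s.active.ncard + ∑ i ∈ Finset.range (k + 1), g (t + i))
    have htD : (insert v s.inactive).ncard = t + 1 :=
      Set.ncard_insert_of_notMem (Set.disjoint_left.1 hs hv) (Set.toFinite _)
    set Φ : Set (Fin n) → ℝ := fun A => Real.exp (τ t * ((s.active.ncard : ℝ) - 1 + A.ncard)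
      + ∑ i ∈ Finset.range k, g (t + 1 + i)) with hΦ
    -- Conditioning on the discovered set A: the first event reads revealed edges, while the second,
    -- from the deterministic state `advance s v A`, reads fresh ones.
    have hsub : {ω : PossibleEdge n → Bool | Survives (graph ω) (k + 1) s}
        ⊆ ⋃ A : Set (Fin n), ({ω | N ω = A} ∩ {ω | Survives (graph ω) k (advance s v A)}) := by
      rintro ω ⟨_, h⟩
      exact Set.mem_iUnion.2 ⟨N ω, rfl, h⟩
    have hterm : ∀ A : Set (Fin n),
        P.real ({ω | N ω = A} ∩ {ω | Survives (graph ω) k (advance s v A)})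
          ≤ P.real {ω | N ω = A} * Φ A := by
      intro A
      by_cases hA : Disjoint A s.inactive
      · have hs' := disjoint_advance hs v hA
        have hdep : DependsOn (fun ω : PossibleEdge n → Bool => N ω = A)
            (revealedEdges s.inactive v) := by
          intro ω ω' h
          simp only [N]
          rw [newlyActive_congr hs hv h]
        rw [hP, randomHypergraph, measureReal_pi_inter_of_dependsOn _ hdep
          (dependsOn_survives k hs') (disjoint_revealedEdges_freshEdges s.inactive v)]
        refine mul_le_mul_of_nonneg_left ((ih hs').trans ?_) measureReal_nonneg
        have hin : (advance s v A).inactive.ncard = t + 1 := htD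
        have hact : ((advance s v A).active.ncard : ℝ) ≤ (s.active.ncard : ℝ) - 1 + A.ncard := by
          have h1 := Set.ncard_sdiff_singleton_add_one (show v ∈ s.active ∪ A from Or.inl hv)
            (Set.toFinite _)
          have h2 := Set.ncard_union_le s.active A
          have h3 : (advance s v A).active.ncard + 1 ≤ s.active.ncard + A.ncard := by
            simp only [advance]; omega
          have h4 : ((advance s v A).active.ncard : ℝ) + 1 ≤ s.active.ncard + A.ncard := by
            exact_mod_cast h3
          linarith
        rw [hin]
        refine Real.exp_le_exp.2 (add_le_add_left ?_ _)
        -- The induction hypothesis carries the tilt τ (t + 1); monotonicity replaces it by the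
        -- larger τ t, at which the exponential moment of this step is taken.
        calc τ (t + 1) * ((advance s v A).active.ncard : ℝ)
            ≤ τ t * ((advance s v A).active.ncard : ℝ) :=
              mul_le_mul_of_nonneg_right (hanti (Nat.le_succ t)) (Nat.cast_nonneg _)
          _ ≤ _ := mul_le_mul_of_nonneg_left hact (hτ t)
      · have : {ω | N ω = A} = ∅ := by
          ext ω
          simp only [Set.mem_ofPred_eq, Set.mem_empty_iff_false, iff_false]
          rintro rfl
          exact hA (newlyActive_disjoint _ _ _)
        simp [this]
    have hint : ∑ A : Set (Fin n), P.real {ω | N ω = A} * Φ A = ∫ ω, Φ (N ω) ∂P := by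
      have h1 : ∀ ω, Φ (N ω) = ∑ A : Set (Fin n), {ω | N ω = A}.indicator (fun _ => Φ A) ω := by
        intro ω
        simp [Set.indicator_apply]
      simp_rw [h1]
      rw [integral_finsetSum _ fun A _ => .of_finite]
      refine Finset.sum_congr rfl fun A _ => ?_
      rw [integral_indicator_const _ .of_discrete, smul_eq_mul]
    have hexp : ∀ ω, Φ (N ω) = Real.exp (τ t * ((s.active.ncard : ℝ) - 1)
        + ∑ i ∈ Finset.range k, g (t + 1 + i)) * Real.exp (τ t * ((N ω).ncard : ℝ)) := by
      intro ω
      rw [hΦ, ← Real.exp_add]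
      ring_nf
    calc P.real {ω | Survives (graph ω) (k + 1) s}
        ≤ ∑ A : Set (Fin n),
          P.real ({ω | N ω = A} ∩ {ω | Survives (graph ω) k (advance s v A)}) :=
          (measureReal_mono hsub).trans (measureReal_iUnion_fintype_le _)
      _ ≤ ∑ A : Set (Fin n), P.real {ω | N ω = A} * Φ A := Finset.sum_le_sum fun A _ => hterm A
      _ = Real.exp (τ t * ((s.active.ncard : ℝ) - 1) + ∑ i ∈ Finset.range k, g (t + 1 + i))
          * ∫ ω, Real.exp (τ t * ((N ω).ncard : ℝ)) ∂P := by
        rw [hint]; simp_rw [hexp]; rw [integral_const_mul]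
      _ ≤ Real.exp (τ t * ((s.active.ncard : ℝ) - 1) + ∑ i ∈ Finset.range k, g (t + 1 + i))
          * Real.exp ((Real.exp (τ t) - 1) * (n * p₂ + t * n * p₃)) :=
        mul_le_mul_of_nonneg_left (integral_exp_newlyActive_le h₂ h₃ hs hv (hτ t))
          (Real.exp_pos _).le
      _ = _ := by
        rw [← Real.exp_add, Finset.sum_range_succ', add_zero]
        have : ∑ i ∈ Finset.range k, g (t + (i + 1)) = ∑ i ∈ Finset.range k, g (t + 1 + i) :=
          Finset.sum_congr rfl fun i _ => by congr 1; ring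
        rw [this]
        congr 1
        simp only [hg]
        ring

end RandomHypergraph

/-! ### The rate function -/

/-- The integrand of the rate. -/
noncomputable def rateDensity (ε r ω : ℝ) : ℝ := 1 - lam ε r ω + Real.log (lam ε r ω)

/-- The logarithm has a singularity where λ vanishes, at ω = 0 if ε = 1. It is integrable there, and
λ is an affine substitution. -/
theorem intervalIntegrable_rateDensity (ε : ℝ) {r : ℝ} (hr : r ≠ 0) (a b : ℝ) :
    IntervalIntegrable (rateDensity ε r) volume a b := by
  have h1 : IntervalIntegrable (fun ω => 1 - lam ε r ω) volume a b := by
    apply Continuous.intervalIntegrable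
    unfold lam
    fun_prop
  have h2 : IntervalIntegrable (fun ω => Real.log (lam ε r ω)) volume a b := by
    have h3 := (intervalIntegral.intervalIntegrable_log' (a := r * a + (1 - ε))
      (b := r * b + (1 - ε))).comp_add_right (1 - ε)
    have h4 := h3.comp_mul_left (c := r)
    simp only [add_sub_cancel_right, mul_div_cancel_left₀ _ hr] at h4
    refine h4.congr fun x _ => ?_
    simp [lam, add_comm]
  exact h1.add h2

/-- The function 1 - z + ln z increases on (0, 1]. The point x = 0 must be excluded: for ε = 1 the
convention `Real.log 0 = 0` gives the value 1 there, while the later values are at most 0. -/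
theorem rateDensity_mono {ε r : ℝ} (hε : ε ≤ 1) (hr : 0 < r) {x y : ℝ} (hx : 0 < x) (hxy : x ≤ y)
    (hy : y ≤ ε / r) : rateDensity ε r x ≤ rateDensity ε r y := by
  have hx' : 0 < lam ε r x := by have := mul_pos hr hx; unfold lam; linarith
  have hxy' : lam ε r x ≤ lam ε r y := by unfold lam; gcongr
  have hy' : lam ε r y ≤ 1 := by
    rw [le_div_iff₀ hr] at hy
    unfold lam; linarith
  have hyp : 0 < lam ε r y := hx'.trans_le hxy'
  have h1 := Real.log_le_sub_one_of_pos (div_pos hx' hyp)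
  rw [Real.log_div hx'.ne' hyp.ne'] at h1
  have h2 : lam ε r x / lam ε r y - 1 ≤ lam ε r x - lam ε r y := by
    rw [div_sub_one hyp.ne', div_le_iff₀ hyp]
    nlinarith
  unfold rateDensity
  linarith

/-- Substituting x = rω leaves 1/r times ∫₀¹ (1 - x + ln x) dx = 1 - 1/2 - 1. -/
theorem rate_one {r : ℝ} (hr : 0 < r) : rate 1 r = -(1 / (2 * r)) := by
  unfold rate
  have h := intervalIntegral.integral_comp_mul_left (a := 0) (b := 1 / r)
    (fun x => 1 - x + Real.log x) hr.ne'
  have h1 : ∀ x, 1 - lam 1 r x + Real.log (lam 1 r x) = 1 - r * x + Real.log (r * x) := by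
    intro x; simp [lam]
  simp_rw [h1]
  rw [h, mul_zero, mul_one_div_cancel hr.ne', intervalIntegral.integral_add
    (Continuous.intervalIntegrable (by fun_prop) _ _) intervalIntegral.intervalIntegrable_log',
    integral_log, intervalIntegral.integral_sub (by simp) (by simp)]
  simp
  field_simp
  norm_num

theorem rate_one_lt_iff {r : ℝ} (hr : 0 < r) : rate 1 r < -2 ↔ r < 1 / 4 := by
  rw [rate_one hr, neg_lt_neg_iff, lt_div_iff₀ (by positivity)]
  constructor <;> intro h <;> linarith

/-! ### The tail bound -/

/-- The number of steps after which the process started with two active vertices is observed. -/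
noncomputable def subcriticalSteps (ε r L : ℝ) : ℕ := ⌊ε * L / r⌋₊ - 1

/-- A left Riemann sum of an increasing function is at most the integral. Starting at 1/L avoids the
singularity at 0. -/
theorem sum_rateDensity_le {ε r L : ℝ} (hε : ε ≤ 1) (hr : 0 < r) (hL : 0 < L) {a : ℕ}
    (ha : ((1 + a : ℝ) / L) ≤ ε / r) :
    ∑ i ∈ Finset.range a, rateDensity ε r ((1 + i) / L)
      ≤ L * ∫ ω in (1 / L)..((1 + a) / L), rateDensity ε r ω := by
  have h1 : MonotoneOn (fun x => rateDensity ε r (x / L)) (Set.Icc 1 (1 + a)) := by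
    rintro x ⟨hx, -⟩ y ⟨-, hy⟩ hxy
    refine rateDensity_mono hε hr (div_pos (by linarith) hL) ?_ (le_trans ?_ ha) <;> gcongr
  refine h1.sum_le_integral.trans_eq ?_
  rw [intervalIntegral.integral_comp_div _ hL.ne', smul_eq_mul]

theorem tail_bound {ε r : ℝ} (hε : 0 < ε) (hε1 : ε ≤ 1) (hr : 0 < r) {n : ℕ} (hn : 1 < n)
    {a : ℕ} (ha : ((1 + a : ℝ) / Real.log n) ≤ ε / r) {v₁ v₂ : Fin n} (hv : v₁ ≠ v₂) :
    (randomHypergraph n ((1 - ε) / n) (r / (n * Real.log n))).real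
        {ω | K₀ ε r * Real.log n ≤ ((component (graph ω) {v₁, v₂}).ncard : ℝ)}
      ≤ Real.exp (-(2 * Real.log (min 1 (lam ε r (1 / Real.log n))))
        + Real.log n * ∫ ω in (1 / Real.log n)..((1 + a) / Real.log n), rateDensity ε r ω) := by
  have hn0 : (0 : ℝ) < n := by positivity
  have hL : 0 < Real.log n := Real.log_pos (by exact_mod_cast hn)
  set L := Real.log n
  have hpos : ∀ t : ℕ, 0 < lam ε r ((1 + t) / L) := fun t => by
    have : 0 < r * ((1 + t) / L) := by positivity
    unfold lam; linarith
  have hmin : ∀ t : ℕ, 0 < min 1 (lam ε r ((1 + t) / L)) := fun t => lt_min one_pos (hpos t)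
  -- The tilt e^τ = 1/λ minimizes (e^τ - 1)λ - τ. The shift from t to 1 + t keeps λ positive at t =
  -- 0 when ε = 1, and the minimum with 1 keeps τ nonnegative past the subcritical window.
  set τ : ℕ → ℝ := fun t => -Real.log (min 1 (lam ε r ((1 + t) / L)))
  have hτ : ∀ t, 0 ≤ τ t := fun t =>
    neg_nonneg.2 (Real.log_nonpos (hmin t).le (min_le_left _ _))
  have hanti : Antitone τ := by
    intro s t hst
    refine neg_le_neg (Real.log_le_log (hmin s) (min_le_min_left _ ?_))
    unfold lam
    gcongr
  have hs : Disjoint (⟨{v₁, v₂}, ∅⟩ : State (Fin n)).active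
    (⟨{v₁, v₂}, ∅⟩ : State (Fin n)).inactive := Set.disjoint_empty _
  have h := measureReal_survives_le (p₂ := (1 - ε) / n) (p₃ := r / (n * L))
    (div_nonneg (by linarith) hn0.le) (by positivity) hτ hanti a hs
  refine (measureReal_mono ?_).trans (h.trans (Real.exp_le_exp.2 ?_))
  · intro ω hω
    refine Reachable.survives Reachable.start a ?_
    -- This is all that is needed of K₀: the threshold lies beyond the observed window.
    have hK : ε / r ≤ K₀ ε r := by
      refine le_trans ?_ (le_max_right _ _)
      gcongr
      linarith
    have : (a : ℝ) ≤ ((component (graph ω) {v₁, v₂}).ncard : ℝ) := by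
      refine le_trans ?_ hω
      rw [div_le_iff₀ hL] at ha
      have := mul_le_mul_of_nonneg_right hK hL.le
      linarith
    simpa using this
  · simp only [Set.ncard_empty, Set.ncard_pair hv, zero_add]
    refine add_le_add (le_of_eq ?_) (le_trans (Finset.sum_le_sum fun i hi => ?_)
      (sum_rateDensity_le hε1 hr hL ha))
    · simp [τ]; ring
    · have hle : lam ε r ((1 + i) / L) ≤ 1 := by
        have : ((1 + i) / L : ℝ) ≤ ε / r := le_trans (by
          have : (i : ℝ) ≤ a := by exact_mod_cast (Finset.mem_range.1 hi).le
          gcongr) ha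
        rw [le_div_iff₀ hr] at this
        unfold lam; linarith
      have hτi : τ i = -Real.log (lam ε r ((1 + i) / L)) := by simp only [τ, min_eq_right hle]
      -- The bound for the mean with i inactive vertices is exactly λ(i/L), so the shift only
      -- weakens the estimate.
      have hmean : (n : ℝ) * ((1 - ε) / n) + (i : ℝ) * n * (r / (n * L))
          ≤ lam ε r ((1 + i) / L) := by
        have h1 : (n : ℝ) * ((1 - ε) / n) + (i : ℝ) * n * (r / (n * L)) = 1 - ε + r * (i / L) := by
          field_simp
        rw [h1]
        unfold lam
        gcongr
        linarith
      have hexp : 0 ≤ Real.exp (τ i) - 1 := by linarith [Real.one_le_exp (hτ i)]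
      have h2 := mul_le_mul_of_nonneg_left hmean hexp
      have h3 : Real.exp (τ i) * lam ε r ((1 + i) / L) = 1 := by
        rw [hτi, Real.exp_neg, Real.exp_log (hpos i), inv_mul_cancel₀ (hpos i).ne']
      unfold rateDensity
      linarith

/-- The error in the exponent of the tail bound. -/
noncomputable def tailError (ε r L : ℝ) : ℝ :=
  -(2 * Real.log (min 1 (lam ε r (1 / L)))) / L
    - (∫ ω in (0 : ℝ)..(1 / L), rateDensity ε r ω)
    + ((∫ ω in (0 : ℝ)..((1 + subcriticalSteps ε r L) / L), rateDensity ε r ω) - rate ε r)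

/-- The two starting vertices cost 2τ(0), which is O(ln L) even for ε = 1 because λ(1/L) ≥ r/L. The
two missing ends of the integral vanish by continuity of the primitive. -/
theorem tendsto_tailError {ε r : ℝ} (hε : 0 < ε) (hε1 : ε ≤ 1) (hr : 0 < r) :
    Tendsto (tailError ε r) atTop (𝓝 0) := by
  have hcont : Continuous fun x => ∫ ω in (0 : ℝ)..x, rateDensity ε r ω :=
    intervalIntegral.continuous_primitive (fun a b => intervalIntegrable_rateDensity ε hr.ne' a b) 0
  have hinv : Tendsto (fun L : ℝ => 1 / L) atTop (𝓝 0) := by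
    simpa using tendsto_inv_atTop_zero (𝕜 := ℝ)
  have h1 : Tendsto (fun L : ℝ => -(2 * Real.log (min 1 (lam ε r (1 / L)))) / L) atTop (𝓝 0) := by
    have hlog : Tendsto (fun L : ℝ => Real.log L / L) atTop (𝓝 0) :=
      Real.isLittleO_log_id_atTop.tendsto_div_nhds_zero
    have hup : Tendsto (fun L : ℝ => 2 * (Real.log L / L) - 2 * Real.log r * (1 / L)) atTop
        (𝓝 0) := by
      simpa using (hlog.const_mul 2).sub (hinv.const_mul (2 * Real.log r))
    refine tendsto_of_tendsto_of_tendsto_of_le_of_le' tendsto_const_nhds hup ?_ ?_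
    · filter_upwards [eventually_gt_atTop 0] with L hL
      have : 0 < r * (1 / L) := by positivity
      have h0 : 0 < min 1 (lam ε r (1 / L)) := lt_min one_pos (by unfold lam; linarith)
      have := Real.log_nonpos h0.le (min_le_left _ _)
      exact div_nonneg (by linarith) hL.le
    · filter_upwards [eventually_gt_atTop 0, eventually_ge_atTop r] with L hL hLr
      have hrL : 0 < r / L := by positivity
      have h0 : r / L ≤ min 1 (lam ε r (1 / L)) := by
        refine le_min ((div_le_one hL).2 hLr) ?_
        unfold lam
        rw [mul_one_div]
        linarith
      have h2 := Real.log_le_log hrL h0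
      rw [Real.log_div hr.ne' hL.ne'] at h2
      calc -(2 * Real.log (min 1 (lam ε r (1 / L)))) / L
          ≤ (2 * Real.log L - 2 * Real.log r) / L := by gcongr; linarith
        _ = _ := by ring
  have h2 : Tendsto (fun L : ℝ => ∫ ω in (0 : ℝ)..(1 / L), rateDensity ε r ω) atTop (𝓝 0) := by
    simpa [Function.comp_def] using (hcont.tendsto 0).comp hinv
  have h3 : Tendsto (fun L : ℝ => (1 + (subcriticalSteps ε r L : ℝ)) / L) atTop (𝓝 (ε / r)) := by
    have hfl := (tendsto_nat_floor_mul_div_atTop (R := ℝ) (div_pos hε hr).le)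
    refine hfl.congr' ?_
    filter_upwards [eventually_ge_atTop (r / ε)] with L hL
    -- With this the natural subtraction in `subcriticalSteps` is a true one, and 1 + a is exactly
    -- the floor.
    have : 1 ≤ ⌊ε * L / r⌋₊ := by
      rw [Nat.one_le_floor_iff, le_div_iff₀ hr]
      rw [div_le_iff₀ hε] at hL
      linarith
    have h4 : (1 + (subcriticalSteps ε r L : ℝ)) = ⌊ε * L / r⌋₊ := by
      unfold subcriticalSteps
      push_cast [this]
      ring
    rw [h4, mul_div_right_comm]
  have h4 : Tendsto (fun L : ℝ => (∫ ω in (0 : ℝ)..((1 + subcriticalSteps ε r L) / L),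
      rateDensity ε r ω) - rate ε r) atTop (𝓝 0) := by
    have := ((hcont.tendsto (ε / r)).comp h3).sub_const (rate ε r)
    rwa [show (∫ ω in (0 : ℝ)..(ε / r), rateDensity ε r ω) = rate ε r from rfl, sub_self] at this
  have := (h1.sub h2).add h4
  rwa [sub_zero, add_zero] at this

theorem tendsto_log_natCast : Tendsto (fun n : ℕ => Real.log n) atTop atTop :=
  Real.tendsto_log_atTop.comp tendsto_natCast_atTop_atTop

/-- The component of two vertices is large with probability at most `n ^ (I + o(1))`. -/
theorem eventually_tail_bound {ε r : ℝ} (hε : 0 < ε) (hε1 : ε ≤ 1) (hr : 0 < r) :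
    ∀ᶠ n : ℕ in atTop, ∀ v₁ v₂ : Fin n, v₁ ≠ v₂ →
      (randomHypergraph n ((1 - ε) / n) (r / (n * Real.log n))).real
          {ω | K₀ ε r * Real.log n ≤ ((component (graph ω) {v₁, v₂}).ncard : ℝ)}
        ≤ (n : ℝ) ^ (rate ε r + tailError ε r (Real.log n)) := by
  filter_upwards [eventually_gt_atTop 1, tendsto_log_natCast.eventually_ge_atTop (r / ε)]
    with n hn hL v₁ v₂ hv
  have hLpos : 0 < Real.log n := Real.log_pos (by exact_mod_cast hn)
  have hfl : 1 ≤ ⌊ε * Real.log n / r⌋₊ := by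
    rw [Nat.one_le_floor_iff, le_div_iff₀ hr]
    rw [div_le_iff₀ hε] at hL
    linarith
  have ha : (1 + (subcriticalSteps ε r (Real.log n) : ℝ)) / Real.log n ≤ ε / r := by
    have h4 : (1 + (subcriticalSteps ε r (Real.log n) : ℝ)) = ⌊ε * Real.log n / r⌋₊ := by
      unfold subcriticalSteps
      push_cast [hfl]
      ring
    rw [h4, div_le_iff₀ hLpos]
    refine (Nat.floor_le (by positivity)).trans_eq (by ring)
  refine (tail_bound hε hε1 hr hn ha hv).trans_eq ?_
  rw [Real.rpow_def_of_pos (by positivity)]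
  congr 1
  have hint := intervalIntegrable_rateDensity ε hr.ne'
  rw [← intervalIntegral.integral_interval_sub_left (hint 0 _) (hint 0 _)]
  unfold tailError
  field_simp
  ring

/-- Below the threshold all components of two vertices are small. -/
theorem tendsto_exists_large_component {ε r : ℝ} (hε : 0 < ε) (hε1 : ε ≤ 1) (hr : 0 < r)
    (hI : rate ε r < -2) :
    Tendsto (fun n : ℕ => (randomHypergraph n ((1 - ε) / n) (r / (n * Real.log n))).real
        {ω | ∃ v₁ v₂ : Fin n, v₁ ≠ v₂ ∧
          K₀ ε r * Real.log n ≤ ((component (graph ω) {v₁, v₂}).ncard : ℝ)})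
      atTop (𝓝 0) := by
  -- Half of the gap δ absorbs the error in the exponent; the other half survives the factor n² of
  -- the union bound.
  set δ := -2 - rate ε r
  have hδ0 : 0 < δ := by linarith
  have hη := (tendsto_tailError hε hε1 hr).comp tendsto_log_natCast
  have hlim : Tendsto (fun n : ℕ => (n : ℝ) ^ (-(δ / 2))) atTop (𝓝 0) :=
    (tendsto_rpow_neg_atTop (by linarith)).comp tendsto_natCast_atTop_atTop
  refine squeeze_zero' (.of_forall fun n => measureReal_nonneg) ?_ hlim
  filter_upwards [eventually_tail_bound hε hε1 hr,
    hη.eventually_lt_const (show 0 < δ / 2 by linarith),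
    eventually_ge_atTop 1] with n hb hn h1
  have hn1 : (1 : ℝ) ≤ n := by exact_mod_cast h1
  set P := randomHypergraph n ((1 - ε) / n) (r / (n * Real.log n))
  set A : Fin n × Fin n → Set (PossibleEdge n → Bool) := fun x => {ω | x.1 ≠ x.2 ∧
    K₀ ε r * Real.log n ≤ ((component (graph ω) {x.1, x.2}).ncard : ℝ)}
  have hA : ∀ x, P.real (A x) ≤ (n : ℝ) ^ (-2 - δ / 2) := by
    intro x
    by_cases hx : x.1 = x.2
    · have : A x = ∅ := by ext ω; simp [A, hx]
      rw [this, measureReal_empty]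
      positivity
    · refine (measureReal_mono fun ω hω => hω.2).trans ((hb x.1 x.2 hx).trans ?_)
      refine Real.rpow_le_rpow_of_exponent_le hn1 ?_
      simp only [Function.comp_apply] at hn
      linarith
  calc P.real _ ≤ P.real (⋃ x, A x) := by
        refine measureReal_mono ?_
        rintro ω ⟨v₁, v₂, h⟩
        exact Set.mem_iUnion.2 ⟨(v₁, v₂), h⟩
    _ ≤ ∑ x, P.real (A x) := measureReal_iUnion_fintype_le _
    _ ≤ ∑ _x : Fin n × Fin n, (n : ℝ) ^ (-2 - δ / 2) := Finset.sum_le_sum fun x _ => hA x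
    _ = (n : ℝ) ^ (2 : ℝ) * (n : ℝ) ^ (-2 - δ / 2) := by
        simp [sq]
    _ = (n : ℝ) ^ (-(δ / 2)) := by
        rw [← Real.rpow_add (by linarith)]
        ring_nf

/-- Below the threshold the random hypergraph is not propagation connected. -/
theorem tendsto_not_propagationConnected {ε r : ℝ} (hε : 0 < ε) (hε1 : ε ≤ 1) (hr : 0 < r)
    (hI : rate ε r < -2) :
    Tendsto (fun n : ℕ => (randomHypergraph n ((1 - ε) / n) (r / (n * Real.log n))).real
        {ω | ¬ PropagationConnected (graph ω)}) atTop (𝓝 1) := by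
  have hlim := (tendsto_exists_large_component hε hε1 hr hI).const_sub 1
  rw [sub_zero] at hlim
  refine tendsto_of_tendsto_of_tendsto_of_le_of_le' hlim tendsto_const_nhds ?_
    (.of_forall fun n => measureReal_le_one)
  have hlog : Tendsto (fun n : ℕ => Real.log n / n) atTop (𝓝 0) :=
    (Real.isLittleO_log_id_atTop.tendsto_div_nhds_zero).comp tendsto_natCast_atTop_atTop
  -- Once K₀ ln n < n, a component containing all vertices counts as large.
  have hsmall : ∀ᶠ n : ℕ in atTop, K₀ ε r * (Real.log n / n) < 1 :=
    (hlog.const_mul (K₀ ε r)).eventually_lt_const (by simp)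
  filter_upwards [hsmall, eventually_ge_atTop 1] with n hn h1
  have : NeZero n := ⟨by omega⟩
  have hn0 : (0 : ℝ) < n := by positivity
  rw [mul_div, div_lt_one hn0] at hn
  set B : Set (PossibleEdge n → Bool) := {ω | ∃ v₁ v₂ : Fin n, v₁ ≠ v₂ ∧
    K₀ ε r * Real.log n ≤ ((component (graph ω) {v₁, v₂}).ncard : ℝ)}
  rw [← probReal_compl_eq_one_sub (s := B) .of_discrete]
  refine measureReal_mono fun ω hω hc => hω ?_
  obtain ⟨v₁, v₂, hv, hC⟩ := hc.exists_component_eq_univ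
  refine ⟨v₁, v₂, hv, ?_⟩
  rw [hC]
  simpa using hn.le

end PropConn

theorem mainTheorem2 :
    -- the tail bound for the component of two starting vertices
    (∀ ε r : ℝ, 0 < ε → ε ≤ 1 → 0 < r →
      ∃ η : ℕ → ℝ, Tendsto η atTop (𝓝 0) ∧
        ∀ᶠ n : ℕ in atTop, ∀ v₁ v₂ : Fin n, v₁ ≠ v₂ →
          (PropConn.randomHypergraph n ((1 - ε) / n) (r / (n * Real.log n))).real
              {ω | PropConn.K₀ ε r * Real.log n
                ≤ ((PropConn.component (PropConn.graph ω) {v₁, v₂}).ncard : ℝ)}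
            ≤ (n : ℝ) ^ (PropConn.rate ε r + η n)) ∧
    -- if `I < -2`, w.h.p. all these components are small and there is no propagation connectivity
    (∀ ε r : ℝ, 0 < ε → ε ≤ 1 → 0 < r → PropConn.rate ε r < -2 →
      Tendsto (fun n : ℕ =>
          (PropConn.randomHypergraph n ((1 - ε) / n) (r / (n * Real.log n))).real
            {ω | ∃ v₁ v₂ : Fin n, v₁ ≠ v₂ ∧ PropConn.K₀ ε r * Real.log n
                ≤ ((PropConn.component (PropConn.graph ω) {v₁, v₂}).ncard : ℝ)})
        atTop (𝓝 0) ∧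
      Tendsto (fun n : ℕ =>
          (PropConn.randomHypergraph n ((1 - ε) / n) (r / (n * Real.log n))).real
            {ω | ¬ PropConn.PropagationConnected (PropConn.graph ω)})
        atTop (𝓝 1)) ∧
    -- the 3-uniform case
    (∀ r : ℝ, 0 < r →
      (PropConn.rate 1 r < -2 ↔ r < 1 / 4) ∧
      (r < 1 / 4 →
        Tendsto (fun n : ℕ =>
            (PropConn.randomHypergraph n 0 (r / (n * Real.log n))).real
              {ω | ¬ PropConn.PropagationConnected (PropConn.graph ω)})
          atTop (𝓝 1))) := by
  refine ⟨fun ε r hε hε1 hr => ⟨fun n => PropConn.tailError ε r (Real.log n),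
      (PropConn.tendsto_tailError hε hε1 hr).comp PropConn.tendsto_log_natCast,
      PropConn.eventually_tail_bound hε hε1 hr⟩,
    fun ε r hε hε1 hr hI => ⟨PropConn.tendsto_exists_large_component hε hε1 hr hI,
      PropConn.tendsto_not_propagationConnected hε hε1 hr hI⟩,
    fun r hr => ⟨PropConn.rate_one_lt_iff hr, fun h => ?_⟩⟩
  -- At ε = 1 the 2-edge probability (1 - ε)/n simplifies to 0.
  simpa using PropConn.tendsto_not_propagationConnected one_pos le_rfl hr
    ((PropConn.rate_one_lt_iff hr).2 h)
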